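/- Let $n\ge 0$ and let $\mathcal{P}$ be a partition of $\{1,\dots,n\}$ into nonempty blocks. For $u\in\mathbb{R}^n$ and $\mathcal{I}\in\mathcal{P}$ let $u_{\mathcal{I}}\in\mathbb{R}^{\mathcal{I}}$ be the subvector of $u$ with coordinates in $\mathcal{I}$. A subspace $\mathcal{U}$ of $\mathbb{R}^n$ is called $\mathcal{P}$-realizable if there is a real symmetric positive semidefinite $n\times n$ matrix $Y$, whose principal submatrix indexed by each $\mathcal{I}\in\mathcal{P}$ is the identity matrix, such that $Yu=0$ for all $u\in\mathcal{U}$. A vector $u\in\mathbb{R}^n$ is called $\mathcal{P}$-balanced if $$\|u_{\mathcal{I}}\|_2\le\sum_{\mathcal{J}\in\mathcal{P}\setminus\{\mathcal{I}\}}\|u_{\mathcal{J}}\|_2\qquad\text{for all }\mathcal{I}\in\mathcal{P}.$$ If a subspace $\mathcal{U}$ of $\mathbb{R}^n$ is $\mathcal{P}$-realizable, then every $u\in\mathcal{U}$ is $\mathcal{P}$-balanced. If $\mathcal{U}=\operatorname{span}\{u\}$ is one-dimensional, then $\mathcal{U}$ is $\mathcal{P}$-realizable if and only if $u$ is $\mathcal{P}$-balanced.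 -/

import Mathlib

noncomputable section

namespace BlockElliptope

variable {n : ℕ}

/-- The map `blkdiag_𝒫`, taking an `n × n` matrix to the tuple of its principal submatrices indexed
by the blocks of `𝒫`. -/
def blkdiag (P : Finpartition (Finset.univ : Finset (Fin n))) (Y : Matrix (Fin n) (Fin n) ℝ) :
    (I : P.parts) → Matrix (I : Finset (Fin n)) (I : Finset (Fin n)) ℝ :=
  fun _ => Y.submatrix Subtype.val Subtype.val

/-- The `𝒫`-elliptope: positive semidefinite matrices (in particular symmetric ones) with
`blkdiag_𝒫 Y = (I, …, I)`. -/
def elliptope (P : Finpartition (Finset.univ : Finset (Fin n))) :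
    Set (Matrix (Fin n) (Fin n) ℝ) :=
  {Y | Y.PosSemidef ∧ blkdiag P Y = fun _ => 1}

/-- The nullspace of a square matrix, as a subspace of Euclidean space. -/
def nullspace (Y : Matrix (Fin n) (Fin n) ℝ) : Submodule ℝ (EuclideanSpace ℝ (Fin n)) :=
  LinearMap.ker (Matrix.toEuclideanLin Y)

/-- A subspace is `𝒫`-realizable if it is contained in the nullspace of an element of the
`𝒫`-elliptope. -/
def IsRealizable (P : Finpartition (Finset.univ : Finset (Fin n)))
    (U : Submodule ℝ (EuclideanSpace ℝ (Fin n))) : Prop :=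
  ∃ Y ∈ elliptope P, U ≤ nullspace Y

/-- The subvector `u_I` of `u` with the coordinates in `I`, carrying the Euclidean norm. -/
def restrict (u : EuclideanSpace ℝ (Fin n)) (I : Finset (Fin n)) : EuclideanSpace ℝ I :=
  WithLp.toLp 2 fun i => u i

/-- A vector is `𝒫`-balanced if `‖u_I‖₂ ≤ ∑_{J ∈ 𝒫 \ {I}} ‖u_J‖₂` for every block `I`. -/
def IsBalanced (P : Finpartition (Finset.univ : Finset (Fin n)))
    (u : EuclideanSpace ℝ (Fin n)) : Prop :=
  ∀ I ∈ P.parts, ‖restrict u I‖ ≤ ∑ J ∈ P.parts \ {I}, ‖restrict u J‖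

end BlockElliptope

end

namespace BlockElliptope

/-! Factor `Y = Bᵀ B`. Identity diagonal blocks make `B` isometric on vectors supported in one
block, so `B u = 0` writes zero as a sum of vectors of lengths `‖u_I‖`, and the triangle inequality
gives balance. Conversely, balance lets a planar polygon with sides `‖u_I‖` close up
(`exists_norm_sum_smul_eq`): `∑ ‖u_I‖ w_I = 0` with unit `w_I`. Let `û` normalize `u` in each block.
The Gram matrix of the vectors `û_i w_I` (`i ∈ I`) kills `u` and has diagonal blocks `û_I û_Iᵀ`.
Adding the projections `1 - û_I û_Iᵀ`, which also kill `u`, makes these blocks the identity. -/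

/-- Adding a complex number of modulus `r` to `v` can produce any modulus allowed by the triangle
inequality. -/
theorem exists_norm_add_smul_eq (v : ℂ) {r t : ℝ} (h₁ : |‖v‖ - r| ≤ t) (h₂ : t ≤ ‖v‖ + r) :
    ∃ w : ℂ, ‖w‖ = 1 ∧ ‖v + r • w‖ = t := by
  obtain ⟨c, hc, hv⟩ : ∃ c : ℂ, ‖c‖ = 1 ∧ v = ‖v‖ * c := by
    refine ⟨Complex.exp (v.arg * Complex.I), Complex.norm_exp_ofReal_mul_I _, ?_⟩
    exact (Complex.norm_mul_exp_arg_mul_I v).symm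
  have hr : 0 ≤ r := by
    have := (le_abs_self _).trans h₁
    linarith
  have hcont : ContinuousOn (fun w : ℂ => ‖v + r • w‖) (Metric.sphere 0 1) := by fun_prop
  have hconn : IsPreconnected (Metric.sphere (0 : ℂ) 1) :=
    isPreconnected_sphere (by simp [Complex.rank_real_complex]) 0 1
  -- The directions `-c` and `c` attain the two extreme moduli; connectedness of the circle supplies
  -- every value between them.
  have hneg : ‖v + r • (-c)‖ = |‖v‖ - r| := by
    have : v + r • (-c) = ((‖v‖ - r : ℝ) : ℂ) * c := by
      conv_lhs => rw [hv]
      rw [Complex.real_smul]; push_cast; ring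
    rw [this, norm_mul, hc, mul_one, Complex.norm_real, Real.norm_eq_abs]
  have hpos : ‖v + r • c‖ = ‖v‖ + r := by
    have : v + r • c = ((‖v‖ + r : ℝ) : ℂ) * c := by
      conv_lhs => rw [hv]
      rw [Complex.real_smul]; push_cast; ring
    rw [this, norm_mul, hc, mul_one, Complex.norm_real, Real.norm_eq_abs,
      abs_of_nonneg (by positivity)]
  obtain ⟨w, hw, hwt⟩ := hconn.intermediate_value (a := -c) (b := c) (by simp [hc]) (by simp [hc])
    hcont (show t ∈ Set.Icc _ _ from ⟨by rw [hneg]; exact h₁, by rw [hpos]; exact h₂⟩)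
  exact ⟨w, by simpa using hw, hwt⟩

/-- The generalized polygon inequality is sufficient for the existence of a planar chain with
prescribed edge lengths and prescribed distance between its ends. -/
theorem exists_norm_sum_smul_eq {ι : Type*} [DecidableEq ι] (s : Finset ι) (r : ι → ℝ)
    (hr : ∀ i, 0 ≤ r i) {t : ℝ} (ht : 0 ≤ t) (hts : t ≤ ∑ i ∈ s, r i)
    (h : ∀ i ∈ s, 2 * r i - ∑ j ∈ s, r j ≤ t) :
    ∃ w : ι → ℂ, (∀ i, ‖w i‖ = 1) ∧ ‖∑ i ∈ s, r i • w i‖ = t := by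
  induction s using Finset.induction_on generalizing t with
  | empty =>
    refine ⟨fun _ => 1, by simp, ?_⟩
    simp only [Finset.sum_empty] at hts ⊢
    simp [le_antisymm hts ht]
  | insert a s ha ih =>
    rw [Finset.sum_insert ha] at hts
    simp only [Finset.sum_insert ha, Finset.mem_insert, forall_eq_or_imp] at h
    have hs : 0 ≤ ∑ i ∈ s, r i := Finset.sum_nonneg fun i _ => hr i
    have hra := hr a
    -- The shorter chain gets the largest end distance its total length allows that `r a` can still
    -- bring down to `t`.
    obtain ⟨w, hw, hwt⟩ := ih (t := min (∑ i ∈ s, r i) (t + r a)) (le_min hs (by linarith))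
      (min_le_left _ _) fun i hi => by
        have h₁ := h.2 i hi
        have h₂ := Finset.single_le_sum (fun j _ => hr j) hi
        exact le_min (by linarith) (by linarith)
    obtain ⟨z, hz, hzt⟩ := exists_norm_add_smul_eq (∑ i ∈ s, r i • w i) (r := r a) (t := t)
      (by
        rw [hwt, abs_le]
        have := min_le_right (∑ i ∈ s, r i) (t + r a)
        have : r a - t ≤ min (∑ i ∈ s, r i) (t + r a) := le_min (by linarith [h.1]) (by linarith)
        constructor <;> linarith)
      (by
        rw [hwt, ← sub_le_iff_le_add]
        exact le_min (by linarith) (by linarith))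
    refine ⟨Function.update w a z, fun i => ?_, ?_⟩
    · by_cases hi : i = a
      · subst hi; simpa using hz
      · simpa [hi] using hw i
    · rw [Finset.sum_insert ha, Function.update_self, add_comm, ← hzt]
      congr 2
      refine Finset.sum_congr rfl fun i hi => ?_
      rw [Function.update_of_ne (ne_of_mem_of_not_mem hi ha)]

section

variable {n : ℕ} (P : Finpartition (Finset.univ : Finset (Fin n)))
  (u : EuclideanSpace ℝ (Fin n))

theorem norm_restrict_sq (I : Finset (Fin n)) : ‖restrict u I‖ ^ 2 = ∑ i ∈ I, u i ^ 2 := by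
  rw [EuclideanSpace.norm_sq_eq, ← Finset.sum_coe_sort I]
  simp [restrict]

theorem sum_parts {M : Type*} [AddCommMonoid M] (f : Fin n → M) :
    ∑ I ∈ P.parts, ∑ i ∈ I, f i = ∑ i, f i := by
  conv_rhs => rw [← P.biUnion_parts, Finset.sum_biUnion P.disjoint]
  rfl

/-- The vector with the coordinates of `u` in `I`, and zeros elsewhere. -/
def extend (I : Finset (Fin n)) : Fin n → ℝ := fun i => if i ∈ I then u i else 0

/-- `‖B x‖² = xᵀ (Bᵀ B) x`, and for `x` supported in `I` only the identity block enters. -/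
theorem norm_toLp_mulVec_extend {B : Matrix (Fin n) (Fin n) ℝ}
    (hB : blkdiag P (B.conjTranspose * B) = fun _ => 1) {I : Finset (Fin n)} (hI : I ∈ P.parts) :
    ‖WithLp.toLp 2 (B.mulVec (extend u I))‖ = ‖restrict u I‖ := by
  have hentry : ∀ i ∈ I, ∀ j ∈ I, (B.conjTranspose * B) i j = if i = j then 1 else 0 := by
    intro i hi j hj
    have := congrFun₂ (congrFun hB ⟨I, hI⟩) ⟨i, hi⟩ ⟨j, hj⟩
    simpa [blkdiag, Matrix.one_apply] using this
  rw [← sq_eq_sq₀ (norm_nonneg _) (norm_nonneg _), norm_restrict_sq, EuclideanSpace.norm_sq_eq]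
  calc ∑ i, ‖B.mulVec (extend u I) i‖ ^ 2
      = B.mulVec (extend u I) ⬝ᵥ B.mulVec (extend u I) := by
        simp [dotProduct, sq]
    _ = extend u I ⬝ᵥ (B.conjTranspose * B).mulVec (extend u I) := by
        rw [← Matrix.mulVec_mulVec, Matrix.conjTranspose_eq_transpose_of_trivial,
          Matrix.dotProduct_mulVec (extend u I), Matrix.vecMul_transpose]
    _ = ∑ i ∈ I, u i ^ 2 := by
        simp only [dotProduct, Matrix.mulVec, extend, ite_mul, mul_ite, zero_mul, mul_zero,
          Finset.sum_ite_mem, Finset.univ_inter]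
        refine Finset.sum_congr rfl fun i hi => ?_
        rw [Finset.sum_congr rfl fun j hj => by rw [hentry i hi j hj]]
        simp [hi, sq]

theorem IsRealizable.isBalanced {U : Submodule ℝ (EuclideanSpace ℝ (Fin n))}
    (hU : IsRealizable P U) (hu : u ∈ U) : IsBalanced P u := by
  obtain ⟨Y, ⟨hY, hdiag⟩, hker⟩ := hU
  obtain ⟨B, rfl⟩ : ∃ B : Matrix (Fin n) (Fin n) ℝ, Y = B.conjTranspose * B := by
    open scoped MatrixOrder in
    exact CStarAlgebra.nonneg_iff_eq_star_mul_self.mp hY.nonneg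
  have hBu : B.mulVec u = 0 := by
    have h : (B.conjTranspose * B).mulVec u = 0 := by
      have := hker hu
      rw [nullspace, LinearMap.mem_ker, Matrix.toLpLin_apply] at this
      simpa using this
    exact (Matrix.conjTranspose_mul_self_mulVec_eq_zero B _).mp h
  set v : Finset (Fin n) → EuclideanSpace ℝ (Fin n) :=
    fun I => WithLp.toLp 2 (B.mulVec (extend u I)) with hv
  have hsum : ∑ I ∈ P.parts, v I = 0 := by
    have hext : ∑ I ∈ P.parts, extend u I = u := by
      ext i
      rw [Finset.sum_apply]
      simp only [extend]
      rw [Finset.sum_eq_single (P.part i)]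
      · simp
      · intro I hI hne
        exact if_neg fun hi => hne (P.part_eq_of_mem hI hi).symm
      · simp
    rw [hv, ← WithLp.toLp_sum, ← Matrix.mulVec_sum, hext, hBu, WithLp.toLp_zero]
  intro I hI
  rw [← Finset.sum_sdiff (Finset.singleton_subset_iff.mpr hI), Finset.sum_singleton] at hsum
  calc ‖restrict u I‖ = ‖v I‖ := (norm_toLp_mulVec_extend P u hdiag hI).symm
    _ = ‖∑ J ∈ P.parts \ {I}, v J‖ := by rw [eq_neg_of_add_eq_zero_right hsum, norm_neg]
    _ ≤ ∑ J ∈ P.parts \ {I}, ‖v J‖ := norm_sum_le _ _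
    _ = ∑ J ∈ P.parts \ {I}, ‖restrict u J‖ := Finset.sum_congr rfl fun J hJ =>
        norm_toLp_mulVec_extend P u hdiag (Finset.mem_sdiff.mp hJ).1

/-- The vector whose restriction to each block is the normalization of the restriction of `u`
(and zero where the latter vanishes). -/
noncomputable def blockNormalize (i : Fin n) : ℝ := u i / ‖restrict u (P.part i)‖

variable {u} in
theorem apply_eq_zero_of_norm_restrict_eq_zero {I : Finset (Fin n)} (h : ‖restrict u I‖ = 0)
    {i : Fin n} (hi : i ∈ I) : u i = 0 := by
  have := norm_restrict_sq u I
  rw [h, zero_pow two_ne_zero, eq_comm, Finset.sum_eq_zero_iff_of_nonneg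
    fun _ _ => sq_nonneg _] at this
  exact pow_eq_zero_iff two_ne_zero |>.mp (this i hi)

theorem blockNormalize_mul_norm (i : Fin n) :
    blockNormalize P u i * ‖restrict u (P.part i)‖ = u i :=
  div_mul_cancel_of_imp fun h => apply_eq_zero_of_norm_restrict_eq_zero h (by simp)

theorem sum_blockNormalize_mul {I : Finset (Fin n)} (hI : I ∈ P.parts) :
    ∑ i ∈ I, blockNormalize P u i * u i = ‖restrict u I‖ := by
  calc ∑ i ∈ I, blockNormalize P u i * u i = ∑ i ∈ I, u i ^ 2 / ‖restrict u I‖ :=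
        Finset.sum_congr rfl fun i hi => by
          rw [blockNormalize, P.part_eq_of_mem hI hi]; ring
    _ = ‖restrict u I‖ := by rw [← Finset.sum_div, ← norm_restrict_sq, sq, mul_self_div_self]

/-- The sum is `1` unless the block of `u` vanishes; then the factor in front is `0`. This form
spares the idempotence proof a case split. -/
theorem blockNormalize_mul_sum_sq (i : Fin n) :
    blockNormalize P u i * ∑ j ∈ P.part i, blockNormalize P u j ^ 2 = blockNormalize P u i := by
  have h : ∑ j ∈ P.part i, blockNormalize P u j ^ 2
      = ‖restrict u (P.part i)‖ / ‖restrict u (P.part i)‖ := by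
    conv_rhs => enter [1]; rw [← sum_blockNormalize_mul P u (P.part_mem.mpr (Finset.mem_univ i))]
    rw [Finset.sum_div]
    refine Finset.sum_congr rfl fun j hj => ?_
    have hp := P.part_eq_of_mem (P.part_mem.mpr (Finset.mem_univ i)) hj
    rw [mul_div_assoc, sq, ← hp]
    rfl
  rw [h]
  by_cases h₀ : ‖restrict u (P.part i)‖ = 0
  · simp [blockNormalize, h₀]
  · rw [div_self h₀, mul_one]

/-- The orthogonal projection, in each block, onto the complement of the restriction of `u`. -/
noncomputable def blockProj : Matrix (Fin n) (Fin n) ℝ := Matrix.of fun i j =>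
  (if i = j then 1 else 0) -
    if j ∈ P.part i then blockNormalize P u i * blockNormalize P u j else 0

theorem mem_part_comm {i j : Fin n} : j ∈ P.part i ↔ i ∈ P.part j := by
  rw [P.mem_part_iff_part_eq_part (by simp) (by simp),
    P.mem_part_iff_part_eq_part (by simp) (by simp), eq_comm]

theorem blockProj_mulVec_apply (x : Fin n → ℝ) (i : Fin n) :
    (blockProj P u).mulVec x i =
      x i - blockNormalize P u i * ∑ j ∈ P.part i, blockNormalize P u j * x j := by
  simp [Matrix.mulVec, dotProduct, blockProj, sub_mul, Finset.sum_sub_distrib, ite_mul,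
    Finset.mul_sum, mul_assoc]

theorem isHermitian_blockProj : (blockProj P u).IsHermitian := by
  ext i j
  simp only [blockProj, Matrix.conjTranspose_apply, Matrix.of_apply, star_trivial,
    mem_part_comm P (i := j), eq_comm (a := j), mul_comm (blockNormalize P u j)]

theorem blockProj_mul_self : blockProj P u * blockProj P u = blockProj P u := by
  refine Matrix.toLin'.injective (LinearMap.ext fun x => funext fun i => ?_)
  rw [Matrix.toLin'_apply, Matrix.toLin'_apply, ← Matrix.mulVec_mulVec, blockProj_mulVec_apply,
    sub_eq_self]
  set c := ∑ j ∈ P.part i, blockNormalize P u j * x j with hc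
  have h : ∑ j ∈ P.part i, blockNormalize P u j * (blockProj P u).mulVec x j
      = c - (∑ j ∈ P.part i, blockNormalize P u j ^ 2) * c := by
    rw [hc, Finset.sum_mul, ← Finset.sum_sub_distrib, ← hc]
    refine Finset.sum_congr rfl fun j hj => ?_
    rw [blockProj_mulVec_apply, P.part_eq_of_mem (P.part_mem.mpr (Finset.mem_univ i)) hj]
    ring
  rw [h, mul_sub, ← mul_assoc, blockNormalize_mul_sum_sq, sub_self]

theorem posSemidef_blockProj : (blockProj P u).PosSemidef := by
  have h := Matrix.posSemidef_conjTranspose_mul_self (blockProj P u)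
  rwa [(isHermitian_blockProj P u).eq, blockProj_mul_self] at h

theorem blockProj_mulVec_self : (blockProj P u).mulVec u = 0 := by
  ext i
  rw [blockProj_mulVec_apply, sum_blockNormalize_mul P u (P.part_mem.mpr (Finset.mem_univ i)),
    blockNormalize_mul_norm, sub_self, Pi.zero_apply]

variable {P u} in
theorem IsBalanced.exists_sum_smul_eq_zero (h : IsBalanced P u) :
    ∃ w : Finset (Fin n) → ℂ, (∀ I, ‖w I‖ = 1) ∧ ∑ I ∈ P.parts, ‖restrict u I‖ • w I = 0 := by
  -- End distance `0` closes the polygon; its side condition is then exactly balance.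
  obtain ⟨w, hw, hsum⟩ := exists_norm_sum_smul_eq P.parts (fun I => ‖restrict u I‖)
    (fun _ => norm_nonneg _) le_rfl (Finset.sum_nonneg fun _ _ => norm_nonneg _) fun I hI => by
      have hI' := h I hI
      rw [← Finset.sum_sdiff (Finset.singleton_subset_iff.mpr hI), Finset.sum_singleton]
      linarith
  exact ⟨w, hw, norm_eq_zero.mp hsum⟩

variable {P u} in
theorem IsBalanced.isRealizable_span (h : IsBalanced P u) :
    IsRealizable P (Submodule.span ℝ {u}) := by
  obtain ⟨w, hw, hsum⟩ := h.exists_sum_smul_eq_zero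
  set g : Fin n → ℂ := fun i => blockNormalize P u i • w (P.part i) with hg
  refine ⟨blockProj P u + Matrix.gram ℝ g,
    ⟨(posSemidef_blockProj P u).add (Matrix.posSemidef_gram ℝ g), ?_⟩, ?_⟩
  · funext I
    ext ⟨i, hi⟩ ⟨j, hj⟩
    have hpi := P.part_eq_of_mem I.2 hi
    have hpj := P.part_eq_of_mem I.2 hj
    simp only [blkdiag, Matrix.submatrix_apply, Matrix.add_apply, Matrix.gram_apply, hg,
      real_inner_smul_left, real_inner_smul_right, hpi, hpj, real_inner_self_eq_norm_sq, hw,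
      blockProj, Matrix.of_apply, Matrix.one_apply, Subtype.mk.injEq]
    -- Since `‖w I‖ = 1`, the Gram entry cancels the term subtracted in the projection.
    rw [if_pos hj]
    ring
  · rw [Submodule.span_singleton_le_iff_mem, nullspace, LinearMap.mem_ker, Matrix.toLpLin_apply]
    -- Block `I` contributes `‖u_I‖ w_I`, so this is the closing relation of the polygon.
    have hgu : ∑ j, u j • g j = 0 := by
      rw [← sum_parts P, ← hsum]
      refine Finset.sum_congr rfl fun I hI => ?_
      rw [← sum_blockNormalize_mul P u hI, Finset.sum_smul]
      refine Finset.sum_congr rfl fun i hi => ?_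
      rw [hg]
      simp only
      rw [P.part_eq_of_mem hI hi, smul_smul, mul_comm]
    have hgram : (Matrix.gram ℝ g).mulVec u = 0 := by
      ext i
      calc (Matrix.gram ℝ g).mulVec u i = inner ℝ (g i) (∑ j, u j • g j) := by
            simp only [inner_sum, real_inner_smul_right, Matrix.mulVec, dotProduct,
              Matrix.gram_apply, mul_comm]
        _ = 0 := by rw [hgu, inner_zero_right]
    rw [Matrix.add_mulVec, blockProj_mulVec_self, hgram, add_zero, WithLp.toLp_zero]

end

end BlockElliptope

theorem corollary5p5 {n : ℕ} (P : Finpartition (Finset.univ : Finset (Fin n)))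
    (U : Submodule ℝ (EuclideanSpace ℝ (Fin n))) :
    (BlockElliptope.IsRealizable P U → ∀ u ∈ U, BlockElliptope.IsBalanced P u) ∧
    (∀ u : EuclideanSpace ℝ (Fin n), U = Submodule.span ℝ {u} → Module.finrank ℝ U = 1 →
      (BlockElliptope.IsRealizable P U ↔ BlockElliptope.IsBalanced P u)) := by
  refine ⟨fun hU u hu => BlockElliptope.IsRealizable.isBalanced P u hU hu, ?_⟩
  rintro u rfl -
  exact ⟨fun hU => BlockElliptope.IsRealizable.isBalanced P u hU
    (Submodule.mem_span_singleton_self u), fun h => h.isRealizable_span⟩
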